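/- Let $d\ge 1$, $V_n=\mathbb Z^d\cap[1,n]^d$, and let $\beta>0$, $\mu>0$. On a probability space let $g_x$ ($x\in\mathbb Z^d$) and $\xi_{x_1,\dots,x_p}$ ($p\ge 2$, $x_i\in\mathbb Z^d$) be jointly independent real random variables with mean zero and variance one, the $\xi$'s being identically distributed. Let $h=h_n$ satisfy $\mu-h_n>0$ for all $n\ge1$ and $$h_n\to\mu,\qquad (\mu-h_n)\sqrt{|V_n|}\to\infty,\qquad \frac1{|V_n|}\sum_{x\in V_n}\mathbb E\big(|g_x|^3:\ |g_x|\ge\varepsilon(\mu-h_n)^{-1}\big)\to 0\quad\text{for every }\varepsilon>0,$$ let $c_n\in\mathbb R$, $c_n\to0$, and let $\boldsymbol\alpha=(\alpha_p)_{p\ge2}$ be real with $|\alpha_p|\le1$. For $\sigma\in\{\pm1\}^{V_n}$ and $p\ge 2$ put $$H_{n;p}(\sigma)=\frac1{|V_n|^{(p-1)/2}}\sum_{x_1,\dots,x_p\in V_n}\xi_{x_1,\dots,x_p}\,\sigma_{x_1}\cdots\sigma_{x_p}.$$ Let $G_{\boldsymbol\alpha}$ be the random Gibbs measure on $\{\pm1\}^{V_n}$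 with weights proportional to $$\exp\Big(\beta\sum_{\langle xy\rangle}\sigma_x\sigma_y+(\mu-h_n)\sum_{x\in V_n}g_x\sigma_x+c_n\sum_{p\ge2}\alpha_p2^{-p}H_{n;p}(\sigma)\Big),$$ where $\langle xy\rangle$ runs over the ordered pairs of nearest neighbours in $V_n$. Let $\langle\,\cdot\,\rangle_{\boldsymbol\alpha}$ be the average over $G_{\boldsymbol\alpha}$ and $\nu_{\boldsymbol\alpha}(\cdot)=\mathbb E\langle\,\cdot\,\rangle_{\boldsymbol\alpha}$. Put $$\Delta_{n;p}(\sigma)=\frac1{|V_n|^{(p+1)/2}}\sum_{x_1,\dots,x_p\in V_n}\widetilde\xi_{x_1,\dots,x_p}\,\sigma_{x_1}\cdots\sigma_{x_p},\qquad p\ge 1,$$ with $\widetilde\xi_{x_1}=g_{x_1}$ for $p=1$ and $\widetilde\xi_{x_1,\dots,x_p}=\xi_{x_1,\dots,x_p}$ for $p\ge2$. Then, for every $n\ge 1$, almost surely the series over $p\ge2$ above converges for every $\sigma$. Moreover, for every $p\ge1$, the random variables $\langle\Delta_{n;p}\rangle_{\boldsymbol\alpha}$ and $\langle|\Delta_{n;p}-\nu_{\boldsymbol\alpha}(\Delta_{n;p})|\rangle_{\boldsymbol\alpha}$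 are integrable for every $n\ge 1$, and $$\nu_{\boldsymbol\alpha}\big(|\Delta_{n;p}-\nu_{\boldsymbol\alpha}(\Delta_{n;p})|\big)\longrightarrow0\qquad(n\to\infty).$$ -/

import Mathlib

open MeasureTheory ProbabilityTheory Filter Topology
open scoped ENNReal

noncomputable section

namespace RFIM

/-- The vertices of the hypercubic lattice `ℤ^d`. -/
abbrev Site (d : ℕ) : Type := Fin d → ℤ

/-- The box `V_n = ℤ^d ∩ [1, n]^d`. -/
def box (d n : ℕ) : Finset (Site d) := Fintype.piFinset fun _ => Finset.Icc (1 : ℤ) (n : ℤ)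

/-- Spin configurations `σ ∈ {±1}^{V_n}` (`ℤˣ` is the set `{1, -1}`). -/
abbrev Config (d n : ℕ) : Type := box d n → ℤˣ

/-- The real number `σ_x ∈ {1, -1}`. -/
def spin {d n : ℕ} (σ : Config d n) (x : box d n) : ℝ := ((σ x : ℤ) : ℝ)

/-- Nearest neighbours: `ℓ¹`-distance one. -/
def Neighbor {d : ℕ} (x y : Site d) : Prop := ∑ i, |x i - y i| = 1

/-- `∑_{⟨xy⟩} σ_x σ_y` over the ordered pairs of nearest neighbours in `V_n`. -/
def neighborSum {d n : ℕ} (σ : Config d n) : ℝ :=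
  open Classical in
  ∑ x : box d n, ∑ y : box d n, if Neighbor x.1 y.1 then spin σ x * spin σ y else 0

/-- The numerical parameters: inverse temperature `β`, field strength `μ - h n` in volume `V_n`,
and the perturbation coefficients `c n` and `α p`. -/
structure Parameters where
  β : ℝ
  μ : ℝ
  h : ℕ → ℝ
  c : ℕ → ℝ
  α : ℕ → ℝ

/-- A realization of the `p`-spin disorder, `v p (x₁, …, x_p)`. -/
abbrev SpinDisorder (d : ℕ) : Type := (p : ℕ) → (Fin p → Site d) → ℝ

/-- `∑_{x₁, …, x_p ∈ V_n} w(x₁, …, x_p) σ_{x₁} ⋯ σ_{x_p}`. -/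
def spinSum {d n : ℕ} (p : ℕ) (w : (Fin p → Site d) → ℝ) (σ : Config d n) : ℝ :=
  ∑ x : Fin p → box d n, w (fun i => (x i).1) * ∏ i, spin σ (x i)

/-- `H_{n;p}(σ) = |V_n|^{-(p-1)/2} ∑ ξ_{x₁, …, x_p} σ_{x₁} ⋯ σ_{x_p}`. -/
def pSpinHamiltonian {d n : ℕ} (v : SpinDisorder d) (p : ℕ) (σ : Config d n) : ℝ :=
  1 / ((box d n).card : ℝ) ^ (((p : ℝ) - 1) / 2) * spinSum p (v p) σ

/-- The term `α_p 2^{-p} H_{n;p}(σ)` of the perturbation. -/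
def perturbationTerm {d n : ℕ} (M : Parameters) (v : SpinDisorder d) (σ : Config d n)
    (p : ℕ) : ℝ :=
  M.α p * ((2 : ℝ) ^ p)⁻¹ * pSpinHamiltonian v p σ

/-- The perturbing Hamiltonian `c_n ∑_{p ≥ 2} α_p 2^{-p} H_{n;p}(σ)`. -/
def perturbation {d n : ℕ} (M : Parameters) (v : SpinDisorder d) (σ : Config d n) : ℝ :=
  M.c n * ∑' p : {p : ℕ // 2 ≤ p}, perturbationTerm M v σ p.1

/-- The exponent of the perturbed Gibbs measure, for disorder `g = u`, `ξ = v`. -/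
def hamiltonian {d n : ℕ} (M : Parameters) (u : Site d → ℝ) (v : SpinDisorder d)
    (σ : Config d n) : ℝ :=
  M.β * neighborSum σ + (M.μ - M.h n) * ∑ x : box d n, u x.1 * spin σ x + perturbation M v σ

/-- The partition function. -/
def partitionFunction {d : ℕ} (n : ℕ) (M : Parameters) (u : Site d → ℝ)
    (v : SpinDisorder d) : ℝ :=
  ∑ σ : Config d n, Real.exp (hamiltonian M u v σ)

/-- The Gibbs probability `G_α({σ})`. -/
def gibbs {d n : ℕ} (M : Parameters) (u : Site d → ℝ) (v : SpinDisorder d)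
    (σ : Config d n) : ℝ :=
  Real.exp (hamiltonian M u v σ) / partitionFunction n M u v

/-- The Gibbs average `⟨f⟩_α` for disorder `g = u`, `ξ = v`. -/
def gibbsAverage {d n : ℕ} (M : Parameters) (u : Site d → ℝ) (v : SpinDisorder d)
    (f : Config d n → ℝ) : ℝ :=
  ∑ σ : Config d n, f σ * gibbs M u v σ

section Random

variable {Ω : Type*} {d : ℕ}

/-- The random variable `⟨f⟩_α` for random `g`, `ξ` and a disorder-dependent observable `f`. -/
def randomAverage (M : Parameters) (g : Site d → Ω → ℝ)
    (ξ : (p : ℕ) → (Fin p → Site d) → Ω → ℝ) {n : ℕ} (f : Ω → Config d n → ℝ) (ω : Ω) : ℝ :=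
  gibbsAverage M (fun x => g x ω) (fun p x => ξ p x ω) (f ω)

/-- `ν_α(f) = 𝔼⟨f⟩_α`. -/
def nu [MeasurableSpace Ω] (P : Measure Ω) (M : Parameters) (g : Site d → Ω → ℝ)
    (ξ : (p : ℕ) → (Fin p → Site d) → Ω → ℝ) {n : ℕ} (f : Ω → Config d n → ℝ) : ℝ :=
  ∫ ω, randomAverage M g ξ f ω ∂P

/-- The disorder with `g` in place of the one-spin part: it is `g_{x₁}` for `p = 1`, and
`ξ_{x₁, …, x_p}` otherwise. -/
def xiTilde (g : Site d → Ω → ℝ) (ξ : (p : ℕ) → (Fin p → Site d) → Ω → ℝ) :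
    (p : ℕ) → (Fin p → Site d) → Ω → ℝ
  | 1, x => g (x 0)
  | p, x => ξ p x

/-- The disorder part `Δ_{n;p} = |V_n|^{-(p+1)/2} ∑ ξ̃_{x₁, …, x_p} σ_{x₁} ⋯ σ_{x_p}`. -/
def Delta (g : Site d → Ω → ℝ) (ξ : (p : ℕ) → (Fin p → Site d) → Ω → ℝ) (n p : ℕ)
    (ω : Ω) (σ : Config d n) : ℝ :=
  1 / ((box d n).card : ℝ) ^ (((p : ℝ) + 1) / 2) * spinSum p (fun x => xiTilde g ξ p x ω) σ

/-- A square-integrable random variable with mean zero and variance one. -/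
structure IsStandardized [MeasurableSpace Ω] (P : Measure Ω) (X : Ω → ℝ) : Prop where
  measurable : Measurable X
  memLp : MemLp X 2 P
  mean : ∫ ω, X ω ∂P = 0
  variance : Var[X; P] = 1

/-- The standing assumptions on the disorder: all variables `g_x` and `ξ_{x₁, …, x_p}`, `p ≥ 2`,
are jointly independent and standardized, and the `ξ`'s are identically distributed. -/
structure IsDisorder [MeasurableSpace Ω] (P : Measure Ω) (g : Site d → Ω → ℝ)
    (ξ : (p : ℕ) → (Fin p → Site d) → Ω → ℝ) : Prop where
  g_standardized : ∀ x, IsStandardized P (g x)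
  xi_standardized : ∀ p, 2 ≤ p → ∀ x, IsStandardized P (ξ p x)
  xi_identDistrib : ∀ p q, 2 ≤ p → 2 ≤ q → ∀ x y, IdentDistrib (ξ p x) (ξ q y) P P
  indep : iIndepFun (β := fun _ : Site d ⊕ (Σ p : {p : ℕ // 2 ≤ p}, (Fin p.1 → Site d)) => ℝ)
    (Sum.elim g fun i => ξ i.1.1 i.2) P

/-- The weak-field condition: `h → μ`, `(μ - h) √|V_n| → ∞`, and
`|V_n|⁻¹ ∑_{x ∈ V_n} 𝔼(|g_x|³ : |g_x| ≥ ε (μ - h)⁻¹) → 0` for every `ε > 0`. -/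
structure WeakField [MeasurableSpace Ω] (P : Measure Ω) (M : Parameters)
    (g : Site d → Ω → ℝ) : Prop where
  tendsto_h : Tendsto M.h atTop (𝓝 M.μ)
  tendsto_field : Tendsto (fun n => (M.μ - M.h n) * √((box d n).card : ℝ)) atTop atTop
  truncated_moment : ∀ ε : ℝ, 0 < ε →
    Tendsto (fun n => ((box d n).card : ℝ≥0∞)⁻¹ *
      ∑ x ∈ box d n, ∫⁻ ω in {ω | ε * (M.μ - M.h n)⁻¹ ≤ |g x ω|},
        ENNReal.ofReal (|g x ω| ^ 3) ∂P) atTop (𝓝 0)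

end Random

end RFIM

end

noncomputable section

namespace RFIM

/-! No concentration argument is needed: since the field strength `μ - h n` and `c n` both tend to
zero, `ν(|Δ|)` itself tends to zero, and the centred quantity is at most `2 ν(|Δ|)`
(`nu_abs_sub_nu_le`). Write `N = |V_n|` and `Δ = H / N`, let `h` be the random part of the exponent
and `w` the Ising weights without disorder. Two uses of Jensen's inequality (`tilted_average_le`)
give, for every `t > 0`, `t ⟨|H|⟩ ≤ log ∑ w exp(h + t|H|) + log ∑ w exp(-h)`. The expectation of
each logarithm is bounded by an annealed computation. Only two moments are available, so exponential
moments may be infinite; the inequality `exp y ≤ exp(y²) (1 + y + y²)` replaces the exponential of a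
linear form by a product whose expectation, by independence, is `∏ (1 + a²)`, at the price of a sum
of squares (`exists_integrable_bound_log_sum_exp`). As every interaction has variance `N`, the
result is `t 𝔼⟨|H|⟩ ≤ log 2 + N (6 ((μ - h)² + c²) + 4 t²)`. Dividing by `N t`, letting `n → ∞` and
then taking `t` small finishes the proof. The exponent involves infinitely many variables, whereas
the product argument is finite: orders `≥ m` are treated as an error whose expectation vanishes as
`m → ∞`. -/

theorem exp_le_quadratic_mul_exp_sq (y : ℝ) :
    Real.exp y ≤ Real.exp (y ^ 2) * (1 + y + y ^ 2) := by
  have hpos : 0 ≤ 1 + y + y ^ 2 := by nlinarith [sq_nonneg (y + 1 / 2)]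
  rcases le_total y 1 with h | h
  -- For `y ≤ 1` the quadratic alone dominates; for `y ≥ 1` the factor `exp (y ^ 2)` alone does.
  · have hy : Real.exp y ≤ 1 + y + y ^ 2 := by
      rcases le_total (-1) y with h' | h'
      · have := Real.abs_exp_sub_one_sub_id_le (abs_le.2 ⟨h', h⟩)
        linarith [(abs_le.1 this).2]
      · have h1 : Real.exp y ≤ 1 := Real.exp_le_one_iff.2 (by linarith)
        nlinarith
    exact hy.trans (le_mul_of_one_le_left hpos (Real.one_le_exp (sq_nonneg y)))
  · have h1 : Real.exp y ≤ Real.exp (y ^ 2) := Real.exp_le_exp.2 (by nlinarith)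
    exact h1.trans (le_mul_of_one_le_right (Real.exp_pos _).le (by nlinarith))

theorem exp_sum_le {ι : Type*} [Fintype ι] (y : ι → ℝ) :
    Real.exp (∑ i, y i) ≤ Real.exp (∑ i, y i ^ 2) * ∏ i, (1 + y i + y i ^ 2) := by
  rw [Real.exp_sum, Real.exp_sum, ← Finset.prod_mul_distrib]
  exact Finset.prod_le_prod (fun i _ => (Real.exp_pos _).le)
    fun i _ => exp_le_quadratic_mul_exp_sq (y i)

/-- The tangent of the logarithm at `m` lies above it. With `m` an upper bound for the mean of a
random `x`, this is a pointwise form of `𝔼 log x ≤ log m`, with an integrable right side. -/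
theorem log_le_log_add_div_sub_one {x m : ℝ} (hx : 0 < x) (hm : 0 < m) :
    Real.log x ≤ Real.log m + (x / m - 1) := by
  have := Real.log_le_sub_one_of_pos (div_pos hx hm)
  rw [Real.log_div hx.ne' hm.ne'] at this
  linarith

/-! ### Deterministic inequalities for finite partition functions -/

section Finite

variable {J : Type*} [Fintype J]

/-- The annealed bound: `log Z ≤ log m + Z' / m - 1`, where `Z'` dominates `Z` up to the
exponential of the sum of the squares. -/
theorem log_sum_exp_le {ι : Type*} [Fintype ι] [Nonempty J] {w : J → ℝ} (hw : ∀ j, 0 < w j)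
    {a : J → ι → ℝ} {b : ι → ℝ} (hab : ∀ j i, |a j i| ≤ b i) (x : ι → ℝ) {m : ℝ} (hm : 0 < m)
    {R : J → ℝ} {ρ : ℝ} (hR : ∀ j, R j ≤ ρ) :
    Real.log (∑ j, w j * Real.exp (∑ i, a j i * x i + R j)) ≤
      ρ + ∑ i, b i ^ 2 * x i ^ 2 + (Real.log m +
        ((∑ j, w j * ∏ i, (1 + a j i * x i + (a j i * x i) ^ 2)) / m - 1)) := by
  have hS : ∀ j, Real.exp (∑ i, a j i * x i + R j) ≤ Real.exp (ρ + ∑ i, b i ^ 2 * x i ^ 2) *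
      ∏ i, (1 + a j i * x i + (a j i * x i) ^ 2) := by
    intro j
    have hpos : 0 ≤ ∏ i, (1 + a j i * x i + (a j i * x i) ^ 2) :=
      Finset.prod_nonneg fun i _ => by nlinarith [sq_nonneg (a j i * x i + 1 / 2)]
    rw [Real.exp_add, Real.exp_add, mul_comm, mul_assoc]
    refine mul_le_mul (Real.exp_le_exp.2 (hR j)) ((exp_sum_le _).trans ?_) (Real.exp_pos _).le
      (Real.exp_pos _).le
    refine mul_le_mul_of_nonneg_right (Real.exp_le_exp.2 (Finset.sum_le_sum fun i _ => ?_)) hpos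
    rw [mul_pow]
    exact mul_le_mul_of_nonneg_right (sq_le_sq' (by linarith [(abs_le.1 (hab j i)).1])
      (abs_le.1 (hab j i)).2) (sq_nonneg _)
  have hpos : 0 < ∑ j, w j * ∏ i, (1 + a j i * x i + (a j i * x i) ^ 2) :=
    Finset.sum_pos (fun j _ => mul_pos (hw j) (Finset.prod_pos fun i _ => by
      nlinarith [sq_nonneg (a j i * x i + 1 / 2)])) Finset.univ_nonempty
  have hle : ∑ j, w j * Real.exp (∑ i, a j i * x i + R j) ≤
      Real.exp (ρ + ∑ i, b i ^ 2 * x i ^ 2) *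
        ∑ j, w j * ∏ i, (1 + a j i * x i + (a j i * x i) ^ 2) := by
    rw [Finset.mul_sum]
    refine Finset.sum_le_sum fun j _ => ?_
    calc _ ≤ _ := mul_le_mul_of_nonneg_left (hS j) (hw j).le
      _ = _ := by ring
  have h0 : 0 < ∑ j, w j * Real.exp (∑ i, a j i * x i + R j) :=
    Finset.sum_pos (fun j _ => mul_pos (hw j) (Real.exp_pos _)) Finset.univ_nonempty
  refine (Real.log_le_log h0 hle).trans ?_
  rw [Real.log_mul (Real.exp_pos _).ne' hpos.ne', Real.log_exp]
  linarith [log_le_log_add_div_sub_one hpos hm]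

theorem sum_mul_le_log_sum_exp {w : J → ℝ} (hw : ∀ j, 0 ≤ w j) (hw1 : ∑ j, w j = 1)
    (f : J → ℝ) : ∑ j, w j * f j ≤ Real.log (∑ j, w j * Real.exp (f j)) := by
  have h := convexOn_exp.map_sum_le (t := Finset.univ) (w := w) (p := f) (fun j _ => hw j) hw1
    fun j _ => Set.mem_univ _
  simp only [smul_eq_mul] at h
  rwa [Real.le_log_iff_exp_le ((Real.exp_pos _).trans_le h)]

/-- Jensen under the tilted measure bounds the average by a difference of logarithms. Jensen for `h`
and for `-h` under `w` turns the negative logarithm into the positive one with `-h`, so that only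
upper bounds on free energies are needed. -/
theorem tilted_average_le {w : J → ℝ} (hw : ∀ j, 0 < w j) (hw1 : ∑ j, w j = 1)
    (f h : J → ℝ) :
    ∑ j, f j * (w j * Real.exp (h j) / ∑ k, w k * Real.exp (h k)) ≤
      Real.log (∑ j, w j * Real.exp (h j + f j)) + Real.log (∑ j, w j * Real.exp (-h j)) := by
  have hne : Nonempty J := by
    by_contra hJ
    rw [not_nonempty_iff] at hJ
    simp at hw1
  set B := ∑ k, w k * Real.exp (h k) with hB
  have hpos : ∀ u : J → ℝ, 0 < ∑ j, w j * Real.exp (u j) := fun u =>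
    Finset.sum_pos (fun j _ => mul_pos (hw j) (Real.exp_pos _)) Finset.univ_nonempty
  have hBpos : 0 < B := hpos h
  have h1 := sum_mul_le_log_sum_exp (w := fun j => w j * Real.exp (h j) / B)
    (fun j => (div_pos (mul_pos (hw j) (Real.exp_pos _)) hBpos).le)
    (by rw [← Finset.sum_div, ← hB, div_self hBpos.ne']) f
  have h2 : ∑ j, w j * Real.exp (h j) / B * Real.exp (f j) =
      (∑ j, w j * Real.exp (h j + f j)) / B := by
    rw [Finset.sum_div]
    exact Finset.sum_congr rfl fun j _ => by rw [Real.exp_add]; ring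
  rw [h2, Real.log_div (hpos _).ne' hBpos.ne'] at h1
  have h3 := sum_mul_le_log_sum_exp (fun j => (hw j).le) hw1 h
  have h4 := sum_mul_le_log_sum_exp (fun j => (hw j).le) hw1 fun j => -h j
  simp only [mul_neg, Finset.sum_neg_distrib] at h4
  have h5 : ∑ j, f j * (w j * Real.exp (h j) / B) = ∑ j, w j * Real.exp (h j) / B * f j :=
    Finset.sum_congr rfl fun j _ => mul_comm _ _
  rw [h5]
  linarith

end Finite

/-! ### Independent standardized variables and annealed bounds -/

section Probability

variable {Ω : Type*} [MeasurableSpace Ω] {P : Measure Ω}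

theorem IsStandardized.integrable_sq {Y : Ω → ℝ} (hY : IsStandardized P Y) :
    Integrable (fun ω => Y ω ^ 2) P := hY.memLp.integrable_sq

theorem integrable_tsum_abs {F : ℕ → Ω → ℝ} (hF : ∀ k, Integrable (F k) P)
    (hS : Summable fun k => ∫ ω, |F k ω| ∂P) :
    (∀ᵐ ω ∂P, Summable fun k => |F k ω|) ∧ Integrable (fun ω => ∑' k, |F k ω|) P := by
  have hlin : ∫⁻ ω, ∑' k, ENNReal.ofReal |F k ω| ∂P ≠ ∞ := by
    rw [lintegral_tsum fun k => (hF k).abs.aemeasurable.ennreal_ofReal]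
    simp only [← ofReal_integral_eq_lintegral_ofReal (hF _).abs
      (ae_of_all _ fun ω => abs_nonneg _)]
    exact hS.tsum_ofReal_ne_top
  have hmeas : AEMeasurable (fun ω => ∑' k, ENNReal.ofReal |F k ω|) P :=
    AEMeasurable.tsum fun k => (hF k).abs.aemeasurable.ennreal_ofReal
  refine ⟨?_, ?_⟩
  · filter_upwards [ae_lt_top' hmeas hlin] with ω hω
    have := ENNReal.summable_toReal hω.ne
    simpa only [ENNReal.toReal_ofReal (abs_nonneg _)] using this
  · refine (integrable_toReal_of_lintegral_ne_top hmeas hlin).congr (ae_of_all _ fun ω => ?_)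
    simp only
    rw [ENNReal.tsum_toReal_eq fun _ => ENNReal.ofReal_ne_top]
    simp only [ENNReal.toReal_ofReal (abs_nonneg _)]

theorem tendsto_integral_tsum_tail {F : ℕ → Ω → ℝ} (hF : ∀ k, Integrable (F k) P)
    (hS : Summable fun k => ∫ ω, |F k ω| ∂P) :
    Tendsto (fun m => ∫ ω, ∑' k, |F (k + m) ω| ∂P) atTop (𝓝 0) := by
  refine (tendsto_sum_nat_add fun k => ∫ ω, |F k ω| ∂P).congr fun m => ?_
  refine integral_tsum_of_summable_integral_norm (fun k => (hF (k + m)).abs) ?_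
  simpa using (summable_nat_add_iff m).2 hS

variable [IsProbabilityMeasure P] {ι : Type*} [Fintype ι] {X : ι → Ω → ℝ}

theorem IsStandardized.integral_sq {Y : Ω → ℝ} (hY : IsStandardized P Y) :
    ∫ ω, Y ω ^ 2 ∂P = 1 := by
  have := variance_eq_sub hY.memLp
  rw [hY.variance, hY.mean] at this
  simpa using this.symm

theorem IsStandardized.integrable {Y : Ω → ℝ} (hY : IsStandardized P Y) : Integrable Y P :=
  hY.memLp.integrable (by norm_num)

theorem IsStandardized.integrable_quadratic {Y : Ω → ℝ} (hY : IsStandardized P Y) (a : ℝ) :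
    Integrable (fun ω => 1 + a * Y ω + (a * Y ω) ^ 2) P := by
  simp only [mul_pow]
  exact ((integrable_const 1).add (hY.integrable.const_mul a)).add
    (hY.integrable_sq.const_mul (a ^ 2))

theorem IsStandardized.integral_quadratic {Y : Ω → ℝ} (hY : IsStandardized P Y) (a : ℝ) :
    ∫ ω, 1 + a * Y ω + (a * Y ω) ^ 2 ∂P = 1 + a ^ 2 := by
  simp only [mul_pow]
  have h1 : Integrable (fun ω => 1 + a * Y ω) P :=
    (integrable_const 1).add (hY.integrable.const_mul a)
  rw [integral_add h1 (hY.integrable_sq.const_mul (a ^ 2)), integral_add (integrable_const 1)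
    (hY.integrable.const_mul a), integral_const_mul, integral_const_mul, hY.mean, hY.integral_sq]
  simp

theorem iIndepFun.integrable_prod_of_integrable (hX : iIndepFun X P)
    (hm : ∀ i, Measurable (X i)) (hi : ∀ i, Integrable (X i) P) :
    Integrable (fun ω => ∏ i, X i ω) P := by
  have hmap := (iIndepFun_iff_map_fun_eq_pi_map fun i => (hm i).aemeasurable).1 hX
  have hint : Integrable (fun x : ι → ℝ => ∏ i, x i)
      (Measure.pi fun i => P.map (X i)) := by
    have : ∀ i, IsProbabilityMeasure (P.map (X i)) := fun i =>
      Measure.isProbabilityMeasure_map (hm i).aemeasurable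
    refine Integrable.fintype_prod (f := fun _ x => x) fun i => ?_
    exact (integrable_map_measure aestronglyMeasurable_id (hm i).aemeasurable).2 (hi i)
  rw [← hmap] at hint
  exact hint.comp_measurable (measurable_pi_lambda _ hm)

theorem integrable_prod_quadratic (hX : iIndepFun X P) (hs : ∀ i, IsStandardized P (X i))
    (a : ι → ℝ) : Integrable (fun ω => ∏ i, (1 + a i * X i ω + (a i * X i ω) ^ 2)) P :=
  iIndepFun.integrable_prod_of_integrable
    (hX.comp (fun i x => 1 + a i * x + (a i * x) ^ 2) fun i => by fun_prop)
    (fun i => by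
      have := (hs i).measurable
      fun_prop)
    fun i => (hs i).integrable_quadratic (a i)

/-- The factors are independent and quadratic, so mean zero and variance one determine the
expectation. -/
theorem integral_prod_quadratic (hX : iIndepFun X P) (hs : ∀ i, IsStandardized P (X i))
    (a : ι → ℝ) :
    ∫ ω, ∏ i, (1 + a i * X i ω + (a i * X i ω) ^ 2) ∂P = ∏ i, (1 + a i ^ 2) := by
  rw [iIndepFun.integral_fun_prod_comp hX (fun i => (hs i).measurable.aemeasurable)
    (f := fun i x => 1 + a i * x + (a i * x) ^ 2)
    fun i => (by fun_prop : Measurable _).aestronglyMeasurable]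
  exact Finset.prod_congr rfl fun i _ => (hs i).integral_quadratic (a i)

theorem integral_sum_mul_sq (hX : iIndepFun X P) (hs : ∀ i, IsStandardized P (X i))
    (a : ι → ℝ) : ∫ ω, (∑ i, a i * X i ω) ^ 2 ∂P = ∑ i, a i ^ 2 := by
  have hL : ∀ i, MemLp (fun ω => a i * X i ω) 2 P := fun i => (hs i).memLp.const_mul (a i)
  have hv := IndepFun.variance_sum (μ := P) (X := fun i ω => a i * X i ω) (s := Finset.univ)
    (fun i _ => hL i) (fun i _ j _ hij =>
      (hX.indepFun hij).comp (measurable_const_mul (a i)) (measurable_const_mul (a j)))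
  have hsum : (∑ i, fun ω => a i * X i ω) = fun ω => ∑ i, a i * X i ω := by
    ext ω; simp
  rw [hsum, variance_eq_sub (by rw [← hsum]; exact memLp_finsetSum' _ fun i _ => hL i)] at hv
  have hmean : ∫ ω, ∑ i, a i * X i ω ∂P = 0 := by
    rw [integral_finsetSum _ fun i _ => (hs i).integrable.const_mul (a i)]
    exact Finset.sum_eq_zero fun i _ => by rw [integral_const_mul, (hs i).mean, mul_zero]
  rw [hmean] at hv
  simp only [variance_const_mul, (hs _).variance, mul_one] at hv
  simpa using hv

/-- A uniform bound on the expected logarithm of a partition function with linear exponents in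
independent standardized variables; `R` is an error term. -/
theorem exists_integrable_bound_log_sum_exp {J : Type*} [Fintype J] [Nonempty J]
    (hX : iIndepFun X P) (hs : ∀ i, IsStandardized P (X i)) {w : J → ℝ} (hw : ∀ j, 0 < w j)
    {a : J → ι → ℝ} {b : ι → ℝ} (hab : ∀ j i, |a j i| ≤ b i) :
    ∃ Q : Ω → ℝ, Integrable Q P ∧
      ∫ ω, Q ω ∂P ≤ Real.log (∑ j, w j) + 2 * ∑ i, b i ^ 2 ∧
      ∀ (ω : Ω) (R : J → ℝ) (ρ : ℝ), (∀ j, R j ≤ ρ) →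
        Real.log (∑ j, w j * Real.exp (∑ i, a j i * X i ω + R j)) ≤ ρ + Q ω := by
  have hW : 0 < ∑ j, w j := Finset.sum_pos (fun j _ => hw j) Finset.univ_nonempty
  have hb : 0 < ∏ i, (1 + b i ^ 2) := Finset.prod_pos fun i _ => by positivity
  -- An upper bound for the expectation of the quadratic partition function, which makes the mean of
  -- the tangent correction nonpositive.
  set m := (∑ j, w j) * ∏ i, (1 + b i ^ 2) with hmdef
  have hm : 0 < m := mul_pos hW hb
  have hi1 : Integrable (fun ω => ∑ i, b i ^ 2 * X i ω ^ 2) P :=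
    integrable_finsetSum _ fun i _ => (hs i).integrable_sq.const_mul _
  have hi2 : Integrable
      (fun ω => ∑ j, w j * ∏ i, (1 + a j i * X i ω + (a j i * X i ω) ^ 2)) P :=
    integrable_finsetSum _ fun j _ => (integrable_prod_quadratic hX hs (a j)).const_mul _
  have hi3 : Integrable (fun ω =>
      (∑ j, w j * ∏ i, (1 + a j i * X i ω + (a j i * X i ω) ^ 2)) / m - 1) P :=
    (hi2.div_const m).sub (integrable_const (1 : ℝ))
  have hi4 : Integrable (fun ω => Real.log m +
      ((∑ j, w j * ∏ i, (1 + a j i * X i ω + (a j i * X i ω) ^ 2)) / m - 1)) P :=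
    (integrable_const _).add hi3
  -- `Q` is chosen before `ω` and `R`, so the error may later depend on `ω`. The sum of squares and
  -- `log m` each contribute one `∑ i, b i ^ 2`, whence the factor 2.
  refine ⟨fun ω => ∑ i, b i ^ 2 * X i ω ^ 2 + (Real.log m +
        ((∑ j, w j * ∏ i, (1 + a j i * X i ω + (a j i * X i ω) ^ 2)) / m - 1)),
    hi1.add hi4, ?_, fun ω R ρ hR => ?_⟩
  · rw [integral_add hi1 hi4, integral_add (integrable_const _) hi3,
      integral_sub (hi2.div_const m) (integrable_const (1 : ℝ)), integral_div,
      integral_finsetSum _ fun i _ => (hs i).integrable_sq.const_mul _,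
      integral_finsetSum _ fun j _ => (integrable_prod_quadratic hX hs (a j)).const_mul _]
    simp only [integral_const_mul, (hs _).integral_sq, integral_prod_quadratic hX hs,
      integral_const, probReal_univ, one_smul, mul_one]
    have h1 : (∑ j, w j * ∏ i, (1 + a j i ^ 2)) / m ≤ 1 := by
      rw [div_le_one hm, hmdef, Finset.sum_mul]
      refine Finset.sum_le_sum fun j _ => mul_le_mul_of_nonneg_left ?_ (hw j).le
      refine Finset.prod_le_prod (fun i _ => by positivity) fun i _ => ?_
      have := sq_le_sq' (by linarith [(abs_le.1 (hab j i)).1]) (abs_le.1 (hab j i)).2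
      linarith
    have h2 : Real.log m ≤ Real.log (∑ j, w j) + ∑ i, b i ^ 2 := by
      rw [hmdef, Real.log_mul hW.ne' hb.ne', Real.log_prod fun i _ => by positivity]
      refine add_le_add_right (Finset.sum_le_sum fun i _ => ?_) _
      have := Real.log_le_sub_one_of_pos (by positivity : 0 < 1 + b i ^ 2)
      linarith
    linarith
  · have := log_sum_exp_le hw hab (fun i => X i ω) hm hR
    linarith

theorem abs_tsum_sub_sum_range_le {f : ℕ → ℝ} (hf : Summable fun k => |f k|) (m : ℕ) :
    |∑' k, f k - ∑ k ∈ Finset.range m, f k| ≤ ∑' k, |f (k + m)| := by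
  have hf' : Summable f := hf.of_abs
  rw [← hf'.sum_add_tsum_nat_add m, add_sub_cancel_left]
  exact norm_tsum_le_tsum_norm (f := fun k => f (k + m)) ((summable_nat_add_iff m).2 hf)

end Probability

/-! ### Spins, Gibbs weights and coupling coefficients -/

section Deterministic

variable {d n : ℕ}

theorem abs_spin (σ : Config d n) (x : box d n) : |spin σ x| = 1 := by
  rcases Int.units_eq_one_or (σ x) with h | h <;> simp [spin, h]

theorem prod_spin_sq {p : ℕ} (σ : Config d n) (x : Fin p → box d n) :
    (∏ i, spin σ (x i)) ^ 2 = 1 := by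
  rw [← sq_abs, Finset.abs_prod]
  simp [abs_spin]

theorem abs_prod_spin {p : ℕ} (σ : Config d n) (x : Fin p → box d n) :
    |∏ i, spin σ (x i)| = 1 := by
  rw [Finset.abs_prod]
  simp [abs_spin]

theorem card_box (d n : ℕ) : (box d n).card = n ^ d := by
  simp [box]

theorem card_box_pos (hn : 1 ≤ n) : 0 < ((box d n).card : ℝ) := by
  rw [card_box]
  exact_mod_cast pow_pos hn d

theorem partitionFunction_pos (M : Parameters) (u : Site d → ℝ) (v : SpinDisorder d) :
    0 < partitionFunction n M u v :=
  Finset.sum_pos (fun _ _ => Real.exp_pos _) Finset.univ_nonempty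

theorem gibbs_nonneg (M : Parameters) (u : Site d → ℝ) (v : SpinDisorder d) (σ : Config d n) :
    0 ≤ gibbs M u v σ :=
  div_nonneg (Real.exp_pos _).le (partitionFunction_pos M u v).le

theorem sum_gibbs (M : Parameters) (u : Site d → ℝ) (v : SpinDisorder d) :
    ∑ σ : Config d n, gibbs M u v σ = 1 := by
  unfold gibbs
  rw [← Finset.sum_div]
  exact div_self (partitionFunction_pos M u v).ne'

theorem gibbs_le_one (M : Parameters) (u : Site d → ℝ) (v : SpinDisorder d) (σ : Config d n) :
    gibbs M u v σ ≤ 1 := by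
  rw [← sum_gibbs M u v]
  exact Finset.single_le_sum (fun σ _ => gibbs_nonneg M u v σ) (Finset.mem_univ σ)

/-- The coefficients of the normalized `(k + 1)`-spin interactions in volume `V_n`. -/
def coupling (M : Parameters) (n : ℕ) : ℕ → ℝ
  | 0 => M.μ - M.h n
  | k + 1 => M.c n * (M.α (k + 2) * ((2 : ℝ) ^ (k + 2))⁻¹)

theorem abs_perturbation_coeff_le {M : Parameters} (hα : ∀ p, 2 ≤ p → |M.α p| ≤ 1) (k : ℕ) :
    |M.α (k + 2) * ((2 : ℝ) ^ (k + 2))⁻¹| ≤ (1 / 2) ^ (k + 2) := by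
  rw [abs_mul, abs_of_pos (by positivity : (0 : ℝ) < ((2 : ℝ) ^ (k + 2))⁻¹), one_div, inv_pow]
  exact mul_le_of_le_one_left (by positivity) (hα _ (by omega))

theorem summable_perturbation_coeff {M : Parameters} (hα : ∀ p, 2 ≤ p → |M.α p| ≤ 1) :
    Summable fun k => |M.α (k + 2) * ((2 : ℝ) ^ (k + 2))⁻¹| :=
  Summable.of_nonneg_of_le (fun _ => abs_nonneg _) (abs_perturbation_coeff_le hα)
    ((summable_nat_add_iff 2).2 (summable_geometric_of_lt_one (by norm_num) (by norm_num)))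

theorem summable_abs_coupling {M : Parameters} (hα : ∀ p, 2 ≤ p → |M.α p| ≤ 1) (n : ℕ) :
    Summable fun k => |coupling M n k| := by
  rw [← summable_nat_add_iff 1]
  simp only [coupling, abs_mul (M.c n)]
  exact (summable_perturbation_coeff hα).mul_left _

/-- Uniformity in `m` is what survives removal of the truncation; it comes from the geometric
factors `2 ^ (-p)`. -/
theorem sum_coupling_sq_le {M : Parameters} (hα : ∀ p, 2 ≤ p → |M.α p| ≤ 1) (n m : ℕ) :
    ∑ k ∈ Finset.range m, coupling M n k ^ 2 ≤ (M.μ - M.h n) ^ 2 + M.c n ^ 2 := by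
  -- The subtracted term strengthens the bound by 1 enough for induction.
  have hgeom : ∀ j : ℕ, ∑ k ∈ Finset.range j, ((1 / 2 : ℝ) ^ (k + 2)) ^ 2 ≤ 1 - (1 / 2) ^ j := by
    intro j
    induction j with
    | zero => simp
    | succ j ih =>
      rw [Finset.sum_range_succ]
      have h0 : (0 : ℝ) < (1 / 2) ^ j := by positivity
      have h1 : (1 / 2 : ℝ) ^ j ≤ 1 := pow_le_one₀ (by norm_num) (by norm_num)
      rw [pow_add, pow_succ (1 / 2 : ℝ) j]
      nlinarith [mul_nonneg h0.le (sub_nonneg.2 h1)]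
  have hbound : ∀ j : ℕ, ∑ k ∈ Finset.range j, coupling M n (k + 1) ^ 2 ≤ M.c n ^ 2 := by
    intro j
    calc ∑ k ∈ Finset.range j, coupling M n (k + 1) ^ 2
        ≤ ∑ k ∈ Finset.range j, M.c n ^ 2 * ((1 / 2 : ℝ) ^ (k + 2)) ^ 2 := by
          refine Finset.sum_le_sum fun k _ => ?_
          rw [coupling, mul_pow]
          refine mul_le_mul_of_nonneg_left ?_ (sq_nonneg _)
          rw [← sq_abs]
          exact pow_le_pow_left₀ (abs_nonneg _) (abs_perturbation_coeff_le hα k) 2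
      _ ≤ M.c n ^ 2 := by
          rw [← Finset.mul_sum]
          refine mul_le_of_le_one_right (sq_nonneg _) ((hgeom j).trans ?_)
          linarith [pow_pos (by norm_num : (0 : ℝ) < 1 / 2) j]
  cases m with
  | zero => simp; positivity
  | succ j =>
    rw [Finset.sum_range_succ', add_comm]
    exact add_le_add_right (hbound j) _

end Deterministic

/-! ### Interactions as linear forms in the disorder -/

section Random

variable {Ω : Type*} {d n : ℕ} {g : Site d → Ω → ℝ} {ξ : (p : ℕ) → (Fin p → Site d) → Ω → ℝ}

/-- The normalized `(k + 1)`-spin interaction, of variance `|V_n|`. -/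
def interaction (g : Site d → Ω → ℝ) (ξ : (p : ℕ) → (Fin p → Site d) → Ω → ℝ) (k : ℕ)
    (σ : Config d n) (ω : Ω) : ℝ :=
  (((box d n).card : ℝ) ^ ((k : ℝ) / 2))⁻¹ *
    spinSum (k + 1) (fun x => xiTilde g ξ (k + 1) x ω) σ

theorem perturbationTerm_eq (M : Parameters) (σ : Config d n) (k : ℕ) (ω : Ω) :
    perturbationTerm M (fun q x => ξ q x ω) σ (k + 2) =
      M.α (k + 2) * ((2 : ℝ) ^ (k + 2))⁻¹ * interaction g ξ (k + 1) σ ω := by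
  unfold perturbationTerm pSpinHamiltonian interaction
  have h : (((k + 2 : ℕ) : ℝ) - 1) / 2 = ((k + 1 : ℕ) : ℝ) / 2 := by push_cast; ring
  rw [h, one_div]
  rfl

theorem interaction_zero (σ : Config d n) (ω : Ω) :
    interaction g ξ 0 σ ω = ∑ x : box d n, g x.1 ω * spin σ x := by
  unfold interaction spinSum
  simp only [Nat.cast_zero, zero_div, Real.rpow_zero, inv_one, one_mul]
  refine Fintype.sum_equiv (Equiv.funUnique (Fin 1) (box d n)) _ _ fun x => ?_
  simp [xiTilde]

theorem Delta_eq (hn : 1 ≤ n) (k : ℕ) (σ : Config d n) (ω : Ω) :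
    Delta g ξ n (k + 1) ω σ = ((box d n).card : ℝ)⁻¹ * interaction g ξ k σ ω := by
  unfold Delta interaction
  have h : (((k + 1 : ℕ) : ℝ) + 1) / 2 = 1 + (k : ℝ) / 2 := by push_cast; ring
  rw [h, Real.rpow_add (card_box_pos hn), Real.rpow_one, one_div, mul_inv, mul_assoc]

/-- The natural numbers index the integers at least `2`. -/
def shiftEquiv : ℕ ≃ {p : ℕ // 2 ≤ p} where
  toFun k := ⟨k + 2, by omega⟩
  invFun p := p.1 - 2
  left_inv k := by simp
  right_inv p := Subtype.ext (Nat.sub_add_cancel p.2)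

theorem summable_perturbationTerm_iff (g : Site d → Ω → ℝ) (M : Parameters) (σ : Config d n)
    (ω : Ω) :
    (Summable fun p : {p : ℕ // 2 ≤ p} => perturbationTerm M (fun q x => ξ q x ω) σ p.1) ↔
      Summable fun k =>
        M.α (k + 2) * ((2 : ℝ) ^ (k + 2))⁻¹ * interaction g ξ (k + 1) σ ω := by
  rw [← shiftEquiv.summable_iff]
  exact summable_congr fun k => perturbationTerm_eq M σ k ω

theorem hamiltonian_eq (M : Parameters) (σ : Config d n) (ω : Ω)
    (hS : Summable fun k => coupling M n k * interaction g ξ k σ ω) :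
    hamiltonian M (fun x => g x ω) (fun p x => ξ p x ω) σ =
      M.β * neighborSum σ + ∑' k, coupling M n k * interaction g ξ k σ ω := by
  have hpert : perturbation M (fun p x => ξ p x ω) σ =
      ∑' k, coupling M n (k + 1) * interaction g ξ (k + 1) σ ω := by
    unfold perturbation
    rw [← shiftEquiv.tsum_eq, ← tsum_mul_left]
    refine tsum_congr fun k => ?_
    rw [coupling, mul_assoc, ← perturbationTerm_eq]
    rfl
  rw [hS.tsum_eq_zero_add, hamiltonian, hpert, interaction_zero, coupling, add_assoc]

/-- The position of `ξ̃_{x₁, …, x_{k+1}}` in the joint family of all disorder variables. -/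
def disorderIndex (d : ℕ) : (Σ k : ℕ, (Fin (k + 1) → Site d)) →
    Site d ⊕ (Σ p : {p : ℕ // 2 ≤ p}, (Fin p.1 → Site d))
  | ⟨0, x⟩ => Sum.inl (x 0)
  | ⟨k + 1, x⟩ => Sum.inr ⟨⟨k + 2, by omega⟩, x⟩

theorem disorderIndex_injective (d : ℕ) : Function.Injective (disorderIndex d) := by
  rintro ⟨_ | k, x⟩ ⟨_ | l, y⟩ h
  · have h0 : x 0 = y 0 := Sum.inl.inj h
    have : x = y := funext fun i => by rw [Fin.fin_one_eq_zero i]; exact h0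
    rw [this]
  · simp [disorderIndex] at h
  · simp [disorderIndex] at h
  · simp only [disorderIndex, Sum.inr.injEq, Sigma.mk.injEq, Subtype.mk.injEq] at h
    obtain ⟨h1, h2⟩ := h
    obtain rfl : k = l := by omega
    rw [eq_of_heq h2]

theorem elim_disorderIndex (i : Σ k : ℕ, (Fin (k + 1) → Site d)) :
    Sum.elim g (fun j : Σ p : {p : ℕ // 2 ≤ p}, (Fin p.1 → Site d) => ξ j.1.1 j.2)
      (disorderIndex d i) = xiTilde g ξ (i.1 + 1) i.2 := by
  obtain ⟨_ | k, x⟩ := i <;> rfl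

/-- The indices of the interactions of order at most `m` in the box. -/
abbrev BoxIndex (d n m : ℕ) : Type := Σ k : Fin m, (Fin (k.1 + 1) → box d n)

/-- The disorder variables in the box. -/
def boxDisorder (g : Site d → Ω → ℝ) (ξ : (p : ℕ) → (Fin p → Site d) → Ω → ℝ) (n m : ℕ)
    (i : BoxIndex d n m) : Ω → ℝ :=
  xiTilde g ξ (i.1.1 + 1) fun l => (i.2 l).1

theorem sum_boxIndex {m : ℕ} (f : (k : ℕ) → (Fin (k + 1) → box d n) → ℝ) :
    ∑ i : BoxIndex d n m, f i.1.1 i.2 = ∑ k ∈ Finset.range m, ∑ x, f k x := by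
  rw [Fintype.sum_sigma, Finset.sum_range]

theorem sum_boxIndex_interaction {m : ℕ} (θ : ℕ → ℝ) (σ : Config d n) (ω : Ω) :
    ∑ i : BoxIndex d n m, θ i.1.1 * (((box d n).card : ℝ) ^ ((i.1.1 : ℝ) / 2))⁻¹ *
        (∏ l, spin σ (i.2 l)) * boxDisorder g ξ n m i ω =
      ∑ k ∈ Finset.range m, θ k * interaction g ξ k σ ω := by
  unfold boxDisorder interaction spinSum
  rw [sum_boxIndex fun k x => θ k * (((box d n).card : ℝ) ^ ((k : ℝ) / 2))⁻¹ *
        (∏ l, spin σ (x l)) * xiTilde g ξ (k + 1) (fun l => (x l).1) ω]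
  refine Finset.sum_congr rfl fun k _ => ?_
  rw [← mul_assoc, Finset.mul_sum]
  exact Finset.sum_congr rfl fun x _ => by ring

/-- There are `N ^ (k + 1)` tuples, each with squared normalization `N ^ (-k)`: every order has
variance `N`, independently of `k`. -/
theorem card_mul_inv_rpow_sq (hn : 1 ≤ n) (k : ℕ) :
    (Fintype.card (Fin (k + 1) → box d n) : ℝ) *
      ((((box d n).card : ℝ) ^ ((k : ℝ) / 2))⁻¹) ^ 2 = (box d n).card := by
  have h0 := card_box_pos (d := d) hn
  have h : (((box d n).card : ℝ) ^ ((k : ℝ) / 2)) ^ 2 = ((box d n).card : ℝ) ^ k := by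
    rw [← Real.rpow_natCast, ← Real.rpow_mul h0.le, Nat.cast_ofNat,
      div_mul_cancel₀ _ (two_ne_zero), Real.rpow_natCast]
  rw [inv_pow, h, Fintype.card_fun, Fintype.card_fin, Fintype.card_coe, Nat.cast_pow, pow_succ,
    mul_comm, ← mul_assoc, inv_mul_cancel₀ (pow_pos h0 k).ne', one_mul]

theorem sum_boxIndex_bound_sq (hn : 1 ≤ n) {m : ℕ} (B : ℕ → ℝ) :
    ∑ i : BoxIndex d n m, (B i.1.1 * (((box d n).card : ℝ) ^ ((i.1.1 : ℝ) / 2))⁻¹) ^ 2 =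
      (box d n).card * ∑ k ∈ Finset.range m, B k ^ 2 := by
  rw [sum_boxIndex fun k _ => (B k * (((box d n).card : ℝ) ^ ((k : ℝ) / 2))⁻¹) ^ 2,
    Finset.mul_sum]
  refine Finset.sum_congr rfl fun k _ => ?_
  rw [Finset.sum_const, Finset.card_univ, nsmul_eq_mul, mul_pow, mul_left_comm,
    card_mul_inv_rpow_sq hn, mul_comm]

variable [MeasurableSpace Ω] {P : Measure Ω}

theorem IsDisorder.standardized (hdis : IsDisorder P g ξ) (k : ℕ) (x : Fin (k + 1) → Site d) :
    IsStandardized P (xiTilde g ξ (k + 1) x) := by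
  cases k with
  | zero => exact hdis.g_standardized _
  | succ k => exact hdis.xi_standardized _ (by omega) _

theorem IsDisorder.iIndepFun_xiTilde (hdis : IsDisorder P g ξ) :
    iIndepFun (fun i : Σ k : ℕ, (Fin (k + 1) → Site d) => xiTilde g ξ (i.1 + 1) i.2) P := by
  have h := hdis.indep.precomp (disorderIndex_injective d)
  have he : (fun i : Σ k : ℕ, (Fin (k + 1) → Site d) => xiTilde g ξ (i.1 + 1) i.2) =
      fun i => Sum.elim g (fun j : Σ p : {p : ℕ // 2 ≤ p}, (Fin p.1 → Site d) => ξ j.1.1 j.2)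
        (disorderIndex d i) := funext fun i => (elim_disorderIndex i).symm
  rw [he]
  exact h

theorem IsDisorder.iIndepFun_boxDisorder (hdis : IsDisorder P g ξ) (n m : ℕ) :
    iIndepFun (boxDisorder g ξ n m) P := by
  refine hdis.iIndepFun_xiTilde.precomp
    (g := fun i : BoxIndex d n m => (⟨i.1.1, fun l => (i.2 l).1⟩ :
      Σ k : ℕ, (Fin (k + 1) → Site d))) ?_
  rintro ⟨k, x⟩ ⟨l, y⟩ h
  simp only [Sigma.mk.injEq] at h
  obtain ⟨h1, h2⟩ := h
  obtain rfl : k = l := Fin.ext h1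
  have := eq_of_heq h2
  have hxy : x = y := funext fun i => Subtype.ext (congrFun this i)
  rw [hxy]

theorem IsDisorder.integrable_interaction_sq (hdis : IsDisorder P g ξ) (k : ℕ)
    (σ : Config d n) : Integrable (fun ω => interaction g ξ k σ ω ^ 2) P := by
  have h : MemLp (fun ω => ∑ x : Fin (k + 1) → box d n,
      xiTilde g ξ (k + 1) (fun i => (x i).1) ω * ∏ i, spin σ (x i)) 2 P :=
    memLp_finsetSum _ fun x _ => (hdis.standardized k _).memLp.mul_const _
  exact (h.const_mul _).integrable_sq

variable [IsProbabilityMeasure P]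

/-- The label set `E` allows several linear exponents per configuration at the cost of `log |E|`;
the two signs of an absolute value are encoded this way. `R` carries the high-order remainder. -/
theorem IsDisorder.exists_bound_log_sum_exp (hdis : IsDisorder P g ξ) (hn : 1 ≤ n) (m : ℕ)
    {E : Type*} [Fintype E] [Nonempty E] {w : Config d n → ℝ} (hw : ∀ σ, 0 < w σ)
    (hw1 : ∑ σ, w σ = 1) {θ : E → ℕ → ℝ} {B : ℕ → ℝ} (hB : ∀ e k, |θ e k| ≤ B k) :
    ∃ Q : Ω → ℝ, Integrable Q P ∧
      ∫ ω, Q ω ∂P ≤ Real.log (Fintype.card E) +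
        2 * ((box d n).card * ∑ k ∈ Finset.range m, B k ^ 2) ∧
      ∀ (ω : Ω) (R : Config d n → ℝ) (ρ : ℝ), (∀ σ, R σ ≤ ρ) →
        Real.log (∑ j : Config d n × E, w j.1 * Real.exp
          (∑ k ∈ Finset.range m, θ j.2 k * interaction g ξ k j.1 ω + R j.1)) ≤ ρ + Q ω := by
  obtain ⟨Q, hQ, hQint, hQle⟩ := exists_integrable_bound_log_sum_exp
    (J := Config d n × E) (hdis.iIndepFun_boxDisorder n m)
    (fun i => hdis.standardized _ _) (w := fun j => w j.1) (fun j => hw j.1)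
    (a := fun j i => θ j.2 i.1.1 * (((box d n).card : ℝ) ^ ((i.1.1 : ℝ) / 2))⁻¹ *
        ∏ l, spin j.1 (i.2 l))
    (b := fun i => B i.1.1 * (((box d n).card : ℝ) ^ ((i.1.1 : ℝ) / 2))⁻¹) (by
      intro j i
      rw [abs_mul, abs_prod_spin, mul_one, abs_mul,
        abs_of_nonneg (by positivity : 0 ≤ (((box d n).card : ℝ) ^ ((i.1.1 : ℝ) / 2))⁻¹)]
      exact mul_le_mul_of_nonneg_right (hB _ _) (by positivity))
  refine ⟨Q, hQ, ?_, fun ω R ρ hR => ?_⟩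
  · rw [sum_boxIndex_bound_sq hn, Fintype.sum_prod_type] at hQint
    simpa [← Finset.mul_sum, hw1] using hQint
  · have h := hQle ω (fun j => R j.1) ρ fun j => hR j.1
    simp only [sum_boxIndex_interaction] at h
    exact h

theorem IsDisorder.integrable_interaction (hdis : IsDisorder P g ξ) (k : ℕ) (σ : Config d n) :
    Integrable (interaction g ξ k σ) P :=
  (integrable_finsetSum _ fun _ _ =>
    (hdis.standardized k _).integrable.mul_const _).const_mul _

theorem IsDisorder.integral_interaction_sq (hdis : IsDisorder P g ξ) (hn : 1 ≤ n) (k : ℕ)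
    (σ : Config d n) : ∫ ω, interaction g ξ k σ ω ^ 2 ∂P = (box d n).card := by
  have h := integral_sum_mul_sq (P := P)
    (X := fun x : Fin (k + 1) → box d n => xiTilde g ξ (k + 1) fun l => (x l).1)
    (hdis.iIndepFun_xiTilde.precomp
      (g := fun x : Fin (k + 1) → box d n => (⟨k, fun l => (x l).1⟩ :
        Σ k : ℕ, (Fin (k + 1) → Site d))) (fun x y hxy => by
          simp only [Sigma.mk.injEq, heq_eq_eq, true_and] at hxy
          exact funext fun i => Subtype.ext (congrFun hxy i)))
    (fun x => hdis.standardized _ _)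
    (fun x => (((box d n).card : ℝ) ^ ((k : ℝ) / 2))⁻¹ * ∏ l, spin σ (x l))
  simp only [mul_pow _ (∏ l, spin σ _), prod_spin_sq, mul_one, Finset.sum_const,
    Finset.card_univ, nsmul_eq_mul, card_mul_inv_rpow_sq hn] at h
  rw [← h]
  refine integral_congr_ae (ae_of_all _ fun ω => ?_)
  simp only [interaction, spinSum]
  rw [Finset.mul_sum]
  exact congrArg (· ^ 2) (Finset.sum_congr rfl fun x _ => by ring)

theorem IsDisorder.integral_abs_interaction_le (hdis : IsDisorder P g ξ) (hn : 1 ≤ n) (k : ℕ)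
    (σ : Config d n) : ∫ ω, |interaction g ξ k σ ω| ∂P ≤ 1 + (box d n).card := by
  rw [← hdis.integral_interaction_sq hn k σ]
  have h1 : ∫ _ω, (1 : ℝ) ∂P = 1 := by simp
  rw [← h1, ← integral_add (integrable_const _) (hdis.integrable_interaction_sq k σ)]
  refine integral_mono (hdis.integrable_interaction k σ).abs
    ((integrable_const _).add (hdis.integrable_interaction_sq k σ)) fun ω => ?_
  have := sq_abs (interaction g ξ k σ ω)
  simp only
  nlinarith [sq_nonneg (|interaction g ξ k σ ω| - 1 / 2)]

theorem IsDisorder.summable_integral_abs (hdis : IsDisorder P g ξ) (hn : 1 ≤ n) {r : ℕ → ℝ}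
    (hr : Summable fun k => |r k|) (j : ℕ) (σ : Config d n) :
    Summable fun k => ∫ ω, |r k * interaction g ξ (k + j) σ ω| ∂P := by
  refine Summable.of_nonneg_of_le (fun k => integral_nonneg fun ω => abs_nonneg _)
    (fun k => ?_) (hr.mul_right (1 + ((box d n).card : ℝ)))
  simp only [abs_mul]
  rw [integral_const_mul]
  exact mul_le_mul_of_nonneg_left (hdis.integral_abs_interaction_le hn _ σ) (abs_nonneg _)

/-- First absolute moments of the interactions are bounded uniformly in the order and the
coefficients are summable, so the sum of absolute values has finite expectation. -/
theorem IsDisorder.ae_summable_perturbationTerm (hdis : IsDisorder P g ξ) (hn : 1 ≤ n)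
    {M : Parameters} (hα : ∀ p, 2 ≤ p → |M.α p| ≤ 1) :
    ∀ᵐ ω ∂P, ∀ σ : Config d n, Summable fun p : {p : ℕ // 2 ≤ p} =>
      perturbationTerm M (fun q x => ξ q x ω) σ p.1 := by
  rw [ae_all_iff]
  intro σ
  have h := (integrable_tsum_abs (fun k => (hdis.integrable_interaction (k + 1) σ).const_mul _)
    (hdis.summable_integral_abs hn (summable_perturbation_coeff hα) 1 σ)).1
  filter_upwards [h] with ω hω
  exact (summable_perturbationTerm_iff g M σ ω).2 hω.of_abs

end Random

/-! ### Gibbs averages and the limit -/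

section Convergence

variable {Ω : Type*} {d n : ℕ} {g : Site d → Ω → ℝ} {ξ : (p : ℕ) → (Fin p → Site d) → Ω → ℝ}

theorem abs_randomAverage_le (M : Parameters) (f : Ω → Config d n → ℝ) (ω : Ω) :
    |randomAverage M g ξ f ω| ≤ randomAverage M g ξ (fun ω σ => |f ω σ|) ω := by
  refine (Finset.abs_sum_le_sum_abs _ _).trans_eq (Finset.sum_congr rfl fun σ _ => ?_)
  rw [abs_mul, abs_of_nonneg (gibbs_nonneg _ _ _ σ)]

theorem randomAverage_abs_sub_le (M : Parameters) (f : Ω → Config d n → ℝ) (a : ℝ) (ω : Ω) :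
    randomAverage M g ξ (fun ω σ => |f ω σ - a|) ω ≤
      randomAverage M g ξ (fun ω σ => |f ω σ|) ω + |a| := by
  have h : |a| = ∑ σ : Config d n, |a| * gibbs M (fun x => g x ω) (fun p x => ξ p x ω) σ := by
    rw [← Finset.mul_sum, sum_gibbs, mul_one]
  rw [h, randomAverage, randomAverage, gibbsAverage, gibbsAverage, ← Finset.sum_add_distrib]
  refine Finset.sum_le_sum fun σ _ => ?_
  rw [← add_mul]
  exact mul_le_mul_of_nonneg_right (abs_sub _ _) (gibbs_nonneg _ _ _ σ)

/-- The Boltzmann weights of the Ising model without disorder. -/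
def isingWeight (β : ℝ) (σ : Config d n) : ℝ :=
  Real.exp (β * neighborSum σ) / ∑ τ : Config d n, Real.exp (β * neighborSum τ)

theorem isingWeight_pos (β : ℝ) (σ : Config d n) : 0 < isingWeight β σ :=
  div_pos (Real.exp_pos _) (Finset.sum_pos (fun _ _ => Real.exp_pos _) Finset.univ_nonempty)

theorem sum_isingWeight (β : ℝ) : ∑ σ : Config d n, isingWeight β σ = 1 := by
  unfold isingWeight
  rw [← Finset.sum_div]
  exact div_self (Finset.sum_pos (fun _ _ => Real.exp_pos _) Finset.univ_nonempty).ne'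

/-- Taking the disorder-free Ising measure as reference makes all later bounds independent of `β`.
-/
theorem gibbs_eq_tilted {M : Parameters} {u : Site d → ℝ} {v : SpinDisorder d}
    {h : Config d n → ℝ} (hh : ∀ σ, hamiltonian M u v σ = M.β * neighborSum σ + h σ)
    (σ : Config d n) :
    gibbs M u v σ = isingWeight M.β σ * Real.exp (h σ) /
      ∑ τ, isingWeight M.β τ * Real.exp (h τ) := by
  have hpos : 0 < ∑ τ : Config d n, Real.exp (M.β * neighborSum τ) :=
    Finset.sum_pos (fun _ _ => Real.exp_pos _) Finset.univ_nonempty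
  unfold gibbs partitionFunction isingWeight
  simp only [hh, Real.exp_add, div_mul_eq_mul_div]
  rw [← Finset.sum_div, div_div_div_cancel_right₀ hpos.ne']

variable [MeasurableSpace Ω] {P : Measure Ω}

theorem IsDisorder.aemeasurable_hamiltonian (hdis : IsDisorder P g ξ) (M : Parameters)
    (σ : Config d n) :
    AEMeasurable (fun ω => hamiltonian M (fun x => g x ω) (fun p x => ξ p x ω) σ) P := by
  have hg : ∀ x, Measurable (g x) := fun x => (hdis.g_standardized x).measurable
  have hpert : AEMeasurable (fun ω => perturbation M (fun p x => ξ p x ω) σ) P := by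
    refine AEMeasurable.const_mul (AEMeasurable.tsum fun p => Measurable.aemeasurable ?_) _
    unfold perturbationTerm pSpinHamiltonian spinSum
    refine Measurable.const_mul (Measurable.const_mul (Finset.measurable_fun_sum _ fun x _ => ?_) _) _
    exact (hdis.xi_standardized p.1 p.2 _).measurable.mul_const _
  refine AEMeasurable.add (AEMeasurable.add aemeasurable_const
    (Measurable.aemeasurable ?_)) hpert
  fun_prop

theorem IsDisorder.aemeasurable_gibbs (hdis : IsDisorder P g ξ) (M : Parameters)
    (σ : Config d n) :
    AEMeasurable (fun ω => gibbs M (fun x => g x ω) (fun p x => ξ p x ω) σ) P := by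
  unfold gibbs partitionFunction
  exact (hdis.aemeasurable_hamiltonian M σ).exp.div
    (Finset.aemeasurable_fun_sum _ fun τ _ => (hdis.aemeasurable_hamiltonian M τ).exp)

theorem IsDisorder.integrable_randomAverage (hdis : IsDisorder P g ξ) (M : Parameters)
    {f : Ω → Config d n → ℝ} (hf : ∀ σ, Integrable (fun ω => f ω σ) P) :
    Integrable (randomAverage M g ξ f) P := by
  refine integrable_finsetSum _ fun σ _ => ?_
  refine (hf σ).mul_bdd (c := 1) (hdis.aemeasurable_gibbs M σ).aestronglyMeasurable
    (ae_of_all _ fun ω => ?_)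
  rw [Real.norm_of_nonneg (gibbs_nonneg _ _ _ σ)]
  exact gibbs_le_one _ _ _ σ

theorem nu_abs_nonneg (M : Parameters) (f : Ω → Config d n → ℝ) :
    0 ≤ nu P M g ξ fun ω σ => |f ω σ| :=
  integral_nonneg fun ω =>
    (abs_nonneg _).trans (abs_randomAverage_le M f ω)

variable [IsProbabilityMeasure P]

theorem IsDisorder.integrable_Delta (hdis : IsDisorder P g ξ) (n k : ℕ) (σ : Config d n) :
    Integrable (fun ω => Delta g ξ n (k + 1) ω σ) P :=
  (integrable_finsetSum _ fun _ _ =>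
    (hdis.standardized k _).integrable.mul_const _).const_mul _

/-- The average of `|H_k|` in the Gibbs measure is bounded by an annealed free energy; the
interactions of order at least `m` enter only through an error term. -/
theorem IsDisorder.mul_integral_average_abs_interaction_le_add (hdis : IsDisorder P g ξ)
    (hn : 1 ≤ n) {M : Parameters} (hα : ∀ p, 2 ≤ p → |M.α p| ≤ 1) {k m : ℕ} (hkm : k < m)
    {t : ℝ} (ht : 0 < t) :
    t * ∫ ω, randomAverage M g ξ (fun ω (σ : Config d n) => |interaction g ξ k σ ω|) ω ∂P ≤
      2 * ∑ σ : Config d n,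
        ∫ ω, ∑' l, |coupling M n (l + m) * interaction g ξ (l + m) σ ω| ∂P +
      (Real.log 2 + (box d n).card *
        (6 * ((M.μ - M.h n) ^ 2 + M.c n ^ 2) + 4 * t ^ 2)) := by
  set r := coupling M n with hr
  have hrs : Summable fun l => |r l| := summable_abs_coupling hα n
  have hrm : Summable fun l => |r (l + m)| := (summable_nat_add_iff m).2 hrs
  set δ : ℕ → ℝ := fun l => if l = k then t else 0 with hδ
  have hδ0 : ∀ l, 0 ≤ δ l := fun l => by
    simp only [hδ]; split_ifs <;> linarith
  -- `Q₁` controls the exponents `h ± t H_k`, which costs `log 2`; `Q₂` below controls `-h`.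
  obtain ⟨Q₁, hQ₁, hI₁, hle₁⟩ := hdis.exists_bound_log_sum_exp hn m (E := ℤˣ)
    (isingWeight_pos M.β) (sum_isingWeight M.β)
    (θ := fun e l => r l + ((e : ℤ) : ℝ) * δ l) (B := fun l => |r l| + δ l) (by
      intro e l
      refine (abs_add_le _ _).trans (add_le_add_right (le_of_eq ?_) _)
      rcases Int.units_eq_one_or e with h | h <;> simp [h, abs_of_nonneg (hδ0 l)])
  obtain ⟨Q₂, hQ₂, hI₂, hle₂⟩ := hdis.exists_bound_log_sum_exp hn m (E := Unit)
    (isingWeight_pos M.β) (sum_isingWeight M.β)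
    (θ := fun _ l => -r l) (B := fun l => |r l|) (fun _ l => (abs_neg _).le)
  have hF : ∀ j (σ : Config d n) (l : ℕ),
      Integrable (fun ω => r (l + j) * interaction g ξ (l + j) σ ω) P :=
    fun j σ l => (hdis.integrable_interaction (l + j) σ).const_mul _
  have htail : ∀ σ : Config d n,
      Integrable (fun ω => ∑' l, |r (l + m) * interaction g ξ (l + m) σ ω|) P := fun σ =>
    (integrable_tsum_abs (hF m σ) (hdis.summable_integral_abs hn hrm m σ)).2
  have hae : ∀ᵐ ω ∂P, ∀ σ : Config d n,
      Summable fun l => |r l * interaction g ξ l σ ω| :=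
    ae_all_iff.2 fun σ =>
      (integrable_tsum_abs (hF 0 σ) (hdis.summable_integral_abs hn hrs 0 σ)).1
  have hρ : Integrable (fun ω => ∑ σ : Config d n,
      ∑' l, |r (l + m) * interaction g ξ (l + m) σ ω|) P :=
    integrable_finsetSum _ fun σ _ => htail σ
  have hpoint : ∀ᵐ ω ∂P,
      t * randomAverage M g ξ (fun ω (σ : Config d n) => |interaction g ξ k σ ω|) ω ≤
      2 * (∑ σ : Config d n, ∑' l, |r (l + m) * interaction g ξ (l + m) σ ω|) +
        (Q₁ ω + Q₂ ω) := by
    filter_upwards [hae] with ω hω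
    set ρ := ∑ σ : Config d n, ∑' l, |r (l + m) * interaction g ξ (l + m) σ ω| with hρdef
    set h : Config d n → ℝ := fun σ => ∑' l, r l * interaction g ξ l σ ω with hh
    set S : Config d n → ℝ := fun σ => ∑ l ∈ Finset.range m, r l * interaction g ξ l σ ω with hS
    -- Summing the tails over all `σ` gives one bound valid for every configuration. It is used for
    -- both signs of the remainder, hence the coefficient 2 of the error.
    have hR : ∀ σ, |h σ - S σ| ≤ ρ := fun σ =>
      (abs_tsum_sub_sum_range_le (hω σ) m).trans
        (Finset.single_le_sum (f := fun σ : Config d n =>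
          ∑' l, |r (l + m) * interaction g ξ (l + m) σ ω|)
          (fun τ _ => tsum_nonneg fun l => abs_nonneg _) (Finset.mem_univ σ))
    have h1 := hle₁ ω (fun σ => h σ - S σ) ρ fun σ => (abs_le.1 (hR σ)).2
    have h2 := hle₂ ω (fun σ => -(h σ - S σ)) ρ fun σ => by
      have := (abs_le.1 (hR σ)).1
      linarith
    have hsum : ∀ (e : ℤˣ) (σ : Config d n),
        ∑ l ∈ Finset.range m, (r l + ((e : ℤ) : ℝ) * δ l) * interaction g ξ l σ ω +
          (h σ - S σ) = h σ + ((e : ℤ) : ℝ) * (t * interaction g ξ k σ ω) := by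
      intro e σ
      simp only [add_mul, Finset.sum_add_distrib, hδ, mul_ite, ite_mul, mul_zero, zero_mul,
        Finset.sum_ite_eq', Finset.mem_range, hkm, if_true, hS]
      ring
    have hsum' : ∀ σ : Config d n, ∑ l ∈ Finset.range m, -r l * interaction g ξ l σ ω +
        -(h σ - S σ) = -h σ := by
      intro σ
      simp only [neg_mul, Finset.sum_neg_distrib, hS]
      ring
    simp only [hsum, Fintype.sum_prod_type] at h1
    simp only [hsum', Fintype.sum_prod_type, Finset.univ_unique, Finset.sum_singleton] at h2
    have hH : ∀ σ : Config d n, hamiltonian M (fun x => g x ω) (fun p x => ξ p x ω) σ =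
        M.β * neighborSum σ + h σ := fun σ => hamiltonian_eq M σ ω (hω σ).of_abs
    have h3 := tilted_average_le (isingWeight_pos (d := d) (n := n) M.β)
      (sum_isingWeight M.β) (fun σ => t * |interaction g ξ k σ ω|) h
    -- `exp(t|H|) ≤ exp(tH) + exp(-tH)`: one of the two signs realizes the absolute value.
    have h4 : ∑ σ, isingWeight M.β σ * Real.exp (h σ + t * |interaction g ξ k σ ω|) ≤
        ∑ σ, ∑ e : ℤˣ, isingWeight M.β σ *
          Real.exp (h σ + ((e : ℤ) : ℝ) * (t * interaction g ξ k σ ω)) := by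
      refine Finset.sum_le_sum fun σ _ => ?_
      have hsingle : ∀ e₀ : ℤˣ, isingWeight M.β σ *
          Real.exp (h σ + ((e₀ : ℤ) : ℝ) * (t * interaction g ξ k σ ω)) ≤
          ∑ e : ℤˣ, isingWeight M.β σ *
            Real.exp (h σ + ((e : ℤ) : ℝ) * (t * interaction g ξ k σ ω)) := fun e₀ =>
        Finset.single_le_sum (f := fun e : ℤˣ => isingWeight M.β σ *
            Real.exp (h σ + ((e : ℤ) : ℝ) * (t * interaction g ξ k σ ω)))
          (fun e _ => mul_nonneg (isingWeight_pos _ σ).le (Real.exp_pos _).le)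
          (Finset.mem_univ e₀)
      rcases abs_choice (interaction g ξ k σ ω) with hc | hc
      · simpa [hc] using hsingle 1
      · simpa [hc] using hsingle (-1)
    have h5 := Real.log_le_log (Finset.sum_pos (fun σ _ => mul_pos (isingWeight_pos M.β σ)
      (Real.exp_pos _)) Finset.univ_nonempty) h4
    have h6 : t * randomAverage M g ξ
        (fun ω (σ : Config d n) => |interaction g ξ k σ ω|) ω =
        ∑ σ : Config d n, t * |interaction g ξ k σ ω| *
          (isingWeight M.β σ * Real.exp (h σ) / ∑ τ, isingWeight M.β τ * Real.exp (h τ)) := by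
      rw [randomAverage, gibbsAverage, Finset.mul_sum]
      exact Finset.sum_congr rfl fun σ _ => by rw [gibbs_eq_tilted hH σ, mul_assoc]
    rw [h6]
    linarith
  have hint : Integrable
      (randomAverage M g ξ fun ω (σ : Config d n) => |interaction g ξ k σ ω|) P :=
    hdis.integrable_randomAverage M fun σ => (hdis.integrable_interaction k σ).abs
  have hQ : Integrable (fun ω => Q₁ ω + Q₂ ω) P := hQ₁.add hQ₂
  have hfin := integral_mono_ae (hint.const_mul t) ((hρ.const_mul 2).add hQ) hpoint
  simp only [Pi.add_apply] at hfin
  rw [integral_const_mul, integral_add (hρ.const_mul 2) hQ,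
    integral_add hQ₁ hQ₂, integral_const_mul, integral_finsetSum _ fun σ _ => htail σ] at hfin
  have hr2 := sum_coupling_sq_le hα n m
  have hδ2 : ∑ l ∈ Finset.range m, δ l ^ 2 = t ^ 2 := by
    simp [hδ, hkm]
  -- By `(x + y)² ≤ 2x² + 2y²`. After the factor 2 of the annealed bound, `Q₁` contributes `4` to
  -- the coupling term and `4 t²`, and `Q₂` contributes `2`, giving `6` and `4`.
  have hB : ∑ l ∈ Finset.range m, (|r l| + δ l) ^ 2 ≤
      2 * ((M.μ - M.h n) ^ 2 + M.c n ^ 2) + 2 * t ^ 2 := by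
    calc _ ≤ ∑ l ∈ Finset.range m, (2 * r l ^ 2 + 2 * δ l ^ 2) :=
          Finset.sum_le_sum fun l _ => by
            nlinarith [sq_nonneg (|r l| - δ l), sq_abs (r l)]
      _ = 2 * ∑ l ∈ Finset.range m, r l ^ 2 + 2 * t ^ 2 := by
          rw [Finset.sum_add_distrib, ← Finset.mul_sum, ← Finset.mul_sum, hδ2]
      _ ≤ _ := by linarith
  have hN := (card_box_pos (d := d) hn).le
  have hB' := mul_le_mul_of_nonneg_left hB hN
  have hr2' := mul_le_mul_of_nonneg_left hr2 hN
  simp only [sq_abs, Fintype.card_units_int, Nat.cast_ofNat, Fintype.card_unit, Nat.cast_one,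
    Real.log_one, zero_add] at hI₁ hI₂
  linarith

/-- The left side does not involve the truncation order `m`, and the expected tails vanish as `m →
∞` with `n` fixed. -/
theorem IsDisorder.mul_integral_average_abs_interaction_le (hdis : IsDisorder P g ξ)
    (hn : 1 ≤ n) {M : Parameters} (hα : ∀ p, 2 ≤ p → |M.α p| ≤ 1) (k : ℕ)
    {t : ℝ} (ht : 0 < t) :
    t * ∫ ω, randomAverage M g ξ (fun ω (σ : Config d n) => |interaction g ξ k σ ω|) ω ∂P ≤
      Real.log 2 + (box d n).card *
        (6 * ((M.μ - M.h n) ^ 2 + M.c n ^ 2) + 4 * t ^ 2) := by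
  have htend : Tendsto (fun m => 2 * ∑ σ : Config d n,
        ∫ ω, ∑' l, |coupling M n (l + m) * interaction g ξ (l + m) σ ω| ∂P +
      (Real.log 2 + (box d n).card *
        (6 * ((M.μ - M.h n) ^ 2 + M.c n ^ 2) + 4 * t ^ 2))) atTop
      (𝓝 (2 * ∑ _σ : Config d n, 0 + (Real.log 2 + (box d n).card *
        (6 * ((M.μ - M.h n) ^ 2 + M.c n ^ 2) + 4 * t ^ 2)))) :=
    ((tendsto_finsetSum _ fun σ _ => tendsto_integral_tsum_tail
      (F := fun l ω => coupling M n l * interaction g ξ l σ ω)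
      (fun l => (hdis.integrable_interaction l σ).const_mul _)
      (hdis.summable_integral_abs hn (summable_abs_coupling hα n) 0 σ)).const_mul 2).add_const _
  simp only [Finset.sum_const_zero, mul_zero, zero_add] at htend
  refine ge_of_tendsto htend ?_
  filter_upwards [eventually_gt_atTop k] with m hm
  exact hdis.mul_integral_average_abs_interaction_le_add hn hα hm ht

theorem IsDisorder.nu_abs_Delta_le (hdis : IsDisorder P g ξ) (hn : 1 ≤ n) {M : Parameters}
    (hα : ∀ p, 2 ≤ p → |M.α p| ≤ 1) (k : ℕ) {t : ℝ} (ht : 0 < t) :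
    nu P M g ξ (fun ω σ => |Delta g ξ n (k + 1) ω σ|) ≤
      (Real.log 2 * ((box d n).card : ℝ)⁻¹ + 6 * ((M.μ - M.h n) ^ 2 + M.c n ^ 2)) / t + 4 * t := by
  have hN := card_box_pos (d := d) hn
  have h := hdis.mul_integral_average_abs_interaction_le hn hα k ht
  have heq : nu P M g ξ (fun ω σ => |Delta g ξ n (k + 1) ω σ|) = ((box d n).card : ℝ)⁻¹ *
      ∫ ω, randomAverage M g ξ (fun ω (σ : Config d n) => |interaction g ξ k σ ω|) ω ∂P := by
    rw [nu, ← integral_const_mul]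
    refine integral_congr_ae (ae_of_all _ fun ω => ?_)
    simp only [randomAverage, gibbsAverage, Finset.mul_sum]
    refine Finset.sum_congr rfl fun σ _ => ?_
    rw [Delta_eq hn, abs_mul, abs_of_pos (inv_pos.2 hN), mul_assoc]
  rw [heq, ← sub_le_iff_le_add, le_div_iff₀ ht]
  have h' := mul_le_mul_of_nonneg_left h (inv_pos.2 hN).le
  rw [mul_add, inv_mul_cancel_left₀ hN.ne'] at h'
  nlinarith

theorem tendsto_card_box_inv (hd : 1 ≤ d) :
    Tendsto (fun n => ((box d n).card : ℝ)⁻¹) atTop (𝓝 0) := by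
  simp only [card_box, Nat.cast_pow]
  exact ((tendsto_pow_atTop (by omega)).comp tendsto_natCast_atTop_atTop).inv_tendsto_atTop

theorem IsDisorder.tendsto_nu_abs_Delta (hdis : IsDisorder P g ξ) (hd : 1 ≤ d) {M : Parameters}
    (hα : ∀ p, 2 ≤ p → |M.α p| ≤ 1) (hh : Tendsto M.h atTop (𝓝 M.μ))
    (hc : Tendsto M.c atTop (𝓝 0)) (k : ℕ) :
    Tendsto (fun n => nu P M g ξ fun ω σ => |Delta g ξ n (k + 1) ω σ|) atTop (𝓝 0) := by
  refine tendsto_order.2 ⟨fun a ha => Eventually.of_forall fun n =>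
    ha.trans_le (nu_abs_nonneg M _), fun ε hε => ?_⟩
  -- With `t = ε / 8` the bound converges to `4t = ε / 2 < ε`.
  have hlim : Tendsto (fun n => (Real.log 2 * ((box d n).card : ℝ)⁻¹ +
      6 * ((M.μ - M.h n) ^ 2 + M.c n ^ 2)) / (ε / 8) + 4 * (ε / 8)) atTop
      (𝓝 ((Real.log 2 * 0 + 6 * ((M.μ - M.μ) ^ 2 + 0 ^ 2)) / (ε / 8) + 4 * (ε / 8))) :=
    ((((tendsto_card_box_inv hd).const_mul _).add
      ((((tendsto_const_nhds.sub hh).pow 2).add (hc.pow 2)).const_mul 6)).div_const _).add_const _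
  filter_upwards [eventually_ge_atTop 1, (tendsto_order.1 hlim).2 ε (by norm_num; linarith)]
    with n hn hlt
  exact (hdis.nu_abs_Delta_le hn hα k (by positivity)).trans_lt hlt

theorem nu_abs_sub_nu_le (M : Parameters) {f : Ω → Config d n → ℝ}
    (hf : Integrable (randomAverage M g ξ fun ω σ => |f ω σ|) P)
    (hf' : Integrable (randomAverage M g ξ fun ω σ => |f ω σ - nu P M g ξ f|) P)
    (hf₀ : Integrable (randomAverage M g ξ f) P) :
    nu P M g ξ (fun ω σ => |f ω σ - nu P M g ξ f|) ≤ 2 * nu P M g ξ fun ω σ => |f ω σ| := by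
  have h1 : |nu P M g ξ f| ≤ nu P M g ξ fun ω σ => |f ω σ| :=
    (abs_integral_le_integral_abs).trans
      (integral_mono hf₀.abs hf fun ω => abs_randomAverage_le M f ω)
  have h2 : nu P M g ξ (fun ω σ => |f ω σ - nu P M g ξ f|) ≤
      (nu P M g ξ fun ω σ => |f ω σ|) + |nu P M g ξ f| := by
    refine (integral_mono hf' (hf.add (integrable_const |nu P M g ξ f|)) fun ω =>
      randomAverage_abs_sub_le M f _ ω).trans_eq ?_
    rw [integral_add' hf (integrable_const _), integral_const, probReal_univ, one_smul]
    rfl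
  linarith

end Convergence

end RFIM

end

theorem mainTheorem7 {Ω : Type*} [MeasurableSpace Ω] (P : Measure Ω) [IsProbabilityMeasure P]
    (d : ℕ) (hd : 1 ≤ d) (M : RFIM.Parameters)
    (g : RFIM.Site d → Ω → ℝ) (ξ : (p : ℕ) → (Fin p → RFIM.Site d) → Ω → ℝ)
    (hβ : 0 < M.β) (hμ : 0 < M.μ) (hfield : ∀ n, 1 ≤ n → 0 < M.μ - M.h n)
    (hc : Tendsto M.c atTop (𝓝 0)) (hα : ∀ p, 2 ≤ p → |M.α p| ≤ 1)
    (hdis : RFIM.IsDisorder P g ξ) (hweak : RFIM.WeakField P M g) :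
    (∀ n, 1 ≤ n → ∀ᵐ ω ∂P, ∀ σ : RFIM.Config d n,
      Summable fun p : {p : ℕ // 2 ≤ p} =>
        RFIM.perturbationTerm M (fun q x => ξ q x ω) σ p.1) ∧
    ∀ p, 1 ≤ p →
      (∀ n, 1 ≤ n →
        Integrable (RFIM.randomAverage M g ξ (RFIM.Delta g ξ n p)) P ∧
        Integrable (RFIM.randomAverage M g ξ fun ω σ =>
          |RFIM.Delta g ξ n p ω σ - RFIM.nu P M g ξ (RFIM.Delta g ξ n p)|) P) ∧
      Tendsto (fun n => RFIM.nu P M g ξ fun ω σ =>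
        |RFIM.Delta g ξ n p ω σ - RFIM.nu P M g ξ (RFIM.Delta g ξ n p)|) atTop (𝓝 0) := by
  refine ⟨fun n hn => hdis.ae_summable_perturbationTerm hn hα, fun p hp => ?_⟩
  obtain ⟨k, rfl⟩ : ∃ k, p = k + 1 := ⟨p - 1, by omega⟩
  have h₀ : ∀ n, Integrable (RFIM.randomAverage M g ξ (RFIM.Delta g ξ n (k + 1))) P := fun n =>
    hdis.integrable_randomAverage M fun σ => hdis.integrable_Delta n k σ
  have h₁ : ∀ n, Integrable (RFIM.randomAverage M g ξ fun ω σ =>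
      |RFIM.Delta g ξ n (k + 1) ω σ|) P := fun n =>
    hdis.integrable_randomAverage M fun σ => (hdis.integrable_Delta n k σ).abs
  have h₂ : ∀ n, Integrable (RFIM.randomAverage M g ξ fun ω σ =>
      |RFIM.Delta g ξ n (k + 1) ω σ - RFIM.nu P M g ξ (RFIM.Delta g ξ n (k + 1))|) P := fun n =>
    hdis.integrable_randomAverage M fun σ =>
      ((hdis.integrable_Delta n k σ).sub (integrable_const _)).abs
  refine ⟨fun n _ => ⟨h₀ n, h₂ n⟩, ?_⟩
  have hlim := (hdis.tendsto_nu_abs_Delta hd hα hweak.tendsto_h hc k).const_mul 2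
  rw [mul_zero] at hlim
  exact squeeze_zero (fun n => RFIM.nu_abs_nonneg M _)
    (fun n => RFIM.nu_abs_sub_nu_le M (h₁ n) (h₂ n) (h₀ n)) hlim
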